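/- Let $(\Lambda,d)$ be a row-finite $k$-graph: a countable small category $\Lambda$ with range and source maps $r,s$ and a degree functor $d\colon\Lambda\to\mathbb{Z}_+^k$ such that every path $\lambda$ with $d(\lambda)=m+n$ factors uniquely as $\lambda=\mu\nu$ with $d(\mu)=m$, $d(\nu)=n$, and such that $v\Lambda^n:=\{\lambda\mid r(\lambda)=v,\ d(\lambda)=n\}$ is finite for all vertices $v\in\Lambda^0$ and all $n\in\mathbb{Z}_+^k$. Let $X(\Lambda)=\{X_n(\Lambda)\}_{n\in\mathbb{Z}_+^k}$ be the associated proper product system with coefficients in $A:=c_0(\Lambda^0)$ (with $\Lambda^0$ discrete): $X_n(\Lambda)$ is the completion of $c_{00}(\Lambda^n)$, $\Lambda^n:=d^{-1}(n)$, for the operations $$\langle\xi,\eta\rangle(v)=\sum_{s(\lambda)=v}\overline{\xi(\lambda)}\,\eta(\lambda),\qquad (\xi a)(\lambda)=\xi(\lambda)a(s(\lambda)),\qquad (a\xi)(\lambda)=a(r(\lambda))\xi(\lambda),$$ with multiplication $\delta_\lambda\delta_\mu=\delta_{\lambda\mu}$ if $s(\lambda)=r(\mu)$ and $\delta_\lambda\delta_\mu=0$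 otherwise. A $2^k$-tuple of $X(\Lambda)$ is a family $\mathcal{L}=\{\mathcal{L}_F\}_{F\subseteq[k]}$ of non-empty subsets of $A$, where $[k]=\{1,\dots,k\}$; it consists of ideals if every $\mathcal{L}_F$ is a norm-closed two-sided ideal of $A$. Write $\underline{i}$, $i\in[k]$, for the generators of $\mathbb{Z}_+^k$ and $X_n^{-1}(I):=\{a\in A\mid\langle X_n(\Lambda),aX_n(\Lambda)\rangle\subseteq I\}$. Given $2^k$-tuples $\mathcal{K}$ and $\mathcal{L}$, the tuple $\mathcal{L}$ is a $\mathcal{K}$-relative O-family of $X(\Lambda)$ if it consists of ideals, $\mathcal{L}_F=X_{\underline{i}}^{-1}(\mathcal{L}_F)\cap\mathcal{L}_{F\cup\{i\}}$ for all $F\subsetneq[k]$ and $i\in[k]\setminus F$, and $\mathcal{K}_F\subseteq\mathcal{L}_F$ for all $F\subseteq[k]$. Put $H_{\mathcal{L},F}:=\{v\in\Lambda^0\mid\delta_v\in\mathcal{L}_F\}$. Let $\mathcal{K}$ and $\mathcal{L}$ be $2^k$-tuples of $X(\Lambda)$ and suppose that $\mathcal{K}$ consists of ideals. Then $\mathcal{L}$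 is a $\mathcal{K}$-relative O-family of $X(\Lambda)$ if and only if the following three conditions hold: (i) $\mathcal{L}$ consists of ideals; (ii) $H_{\mathcal{L},F}=\{v\in\Lambda^0\mid s(v\Lambda^{\underline{i}})\subseteq H_{\mathcal{L},F}\}\cap H_{\mathcal{L},F\cup\{i\}}$ for all $F\subsetneq[k]$ and $i\in[k]\setminus F$; (iii) $H_{\mathcal{K},F}\subseteq H_{\mathcal{L},F}$ for all $F\subseteq[k]$. -/

import Mathlib

open CategoryTheory Filter Topology
open scoped ENNReal ZeroAtInfty

universe u v w

noncomputable section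

set_option linter.unusedSectionVars false

/-! ### C*-correspondences -/

/-- A right Hilbert module over the C*-algebra `A`: a Banach space `E` with a right action of `A`
and an `A`-valued inner product, linear in the second variable, that induces the norm of `E`.
Positivity of `⟨x, x⟩` is expressed by `⟨x, x⟩ = a* a` for some `a : A`. -/
class HilbertModule (A : Type u) [NonUnitalCStarAlgebra A] (E : Type w)
    [NormedAddCommGroup E] [NormedSpace ℂ E] where
  complete : CompleteSpace E
  ract : E → A → E
  ip : E → E → A
  add_ract : ∀ (x y : E) (a : A), ract (x + y) a = ract x a + ract y a
  ract_add : ∀ (x : E) (a b : A), ract x (a + b) = ract x a + ract x b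
  smul_ract : ∀ (c : ℂ) (x : E) (a : A), ract (c • x) a = c • ract x a
  ract_smul : ∀ (c : ℂ) (x : E) (a : A), ract x (c • a) = c • ract x a
  ract_mul : ∀ (x : E) (a b : A), ract x (a * b) = ract (ract x a) b
  ip_add_right : ∀ x y z : E, ip x (y + z) = ip x y + ip x z
  ip_smul_right : ∀ (c : ℂ) (x y : E), ip x (c • y) = c • ip x y
  ip_ract_right : ∀ (x y : E) (a : A), ip x (ract y a) = ip x y * a
  star_ip : ∀ x y : E, star (ip x y) = ip y x
  ip_self_nonneg : ∀ x : E, ∃ a : A, ip x x = star a * a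
  norm_sq_eq : ∀ x : E, ‖x‖ ^ 2 = ‖ip x x‖

/-- A C*-correspondence over `A`: a right Hilbert `A`-module with a `*`-homomorphism `φ` from `A`
to the adjointable operators. The last field says that `φ a` is adjointable with adjoint
`φ (a*)`. -/
class CStarCorrespondence (A : Type u) [NonUnitalCStarAlgebra A] (E : Type w)
    [NormedAddCommGroup E] [NormedSpace ℂ E] extends HilbertModule A E where
  φ : A →ₙₐ[ℂ] (E →L[ℂ] E)
  φ_adjoint : ∀ (a : A) (x y : E), ip (φ a x) y = ip x (φ (star a) y)

/-- The (generalised) compact operators on a right Hilbert module: the norm-closed linear span of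
the rank-one operators `ζ ↦ ξ ⟨η, ζ⟩`. -/
def compactOperators (A : Type u) [NonUnitalCStarAlgebra A] (E : Type w)
    [NormedAddCommGroup E] [NormedSpace ℂ E] [HilbertModule A E] : Submodule ℂ (E →L[ℂ] E) :=
  (Submodule.span ℂ {T : E →L[ℂ] E | ∃ ξ η : E, ∀ ζ : E,
    T ζ = HilbertModule.ract ξ (HilbertModule.ip (A := A) η ζ)}).topologicalClosure

/-- If `φ s` is compact for all `s` in a set with dense linear span, then `φ a` is compact for all
`a`. -/
theorem φ_mem_compactOperators {A : Type u} [NonUnitalCStarAlgebra A] {E : Type w}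
    [NormedAddCommGroup E] [NormedSpace ℂ E] [CStarCorrespondence A E] {S : Set A}
    (hS : (Submodule.span ℂ S).topologicalClosure = ⊤)
    (hb : ∀ (a : A) (x : E), ‖CStarCorrespondence.φ a x‖ ≤ ‖a‖ * ‖x‖)
    (h : ∀ s ∈ S, CStarCorrespondence.φ s ∈ compactOperators A E) (a : A) :
    CStarCorrespondence.φ a ∈ compactOperators A E := by
  let Φ : A →L[ℂ] (E →L[ℂ] E) :=
    LinearMap.mkContinuous
      { toFun := fun a => CStarCorrespondence.φ a
        map_add' := fun a b => map_add _ a b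
        map_smul' := fun c a => map_smul CStarCorrespondence.φ c a } 1 (fun a => by
      rw [one_mul]
      exact ContinuousLinearMap.opNorm_le_bound _ (norm_nonneg a) (hb a))
  have hK : IsClosed (compactOperators A E : Set (E →L[ℂ] E)) :=
    Submodule.isClosed_topologicalClosure _
  have hcl : IsClosed (((compactOperators A E).comap Φ.toLinearMap : Submodule ℂ A) : Set A) :=
    hK.preimage Φ.continuous
  suffices h' : (⊤ : Submodule ℂ A) ≤ (compactOperators A E).comap Φ.toLinearMap from
    h' (Submodule.mem_top (x := a))
  rw [← hS]
  refine Submodule.topologicalClosure_minimal _ ?_ hcl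
  rw [Submodule.span_le]
  exact h

/-- Finite sums of rank-one operators are compact. -/
theorem mem_compactOperators_of_sum {A : Type u} [NonUnitalCStarAlgebra A] {E : Type w}
    [NormedAddCommGroup E] [NormedSpace ℂ E] [HilbertModule A E] {ι : Type*} (s : Finset ι)
    (T : E →L[ℂ] E) (Θ : ι → E →L[ℂ] E) (e : ι → E)
    (hΘ : ∀ q ζ, Θ q ζ = HilbertModule.ract (e q) (HilbertModule.ip (A := A) (e q) ζ))
    (hT : ∀ ζ, T ζ = ∑ q ∈ s, HilbertModule.ract (e q) (HilbertModule.ip (A := A) (e q) ζ)) :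
    T ∈ compactOperators A E := by
  have : T = ∑ q ∈ s, Θ q := by
    ext ζ
    rw [hT, sum_apply]
    exact Finset.sum_congr rfl fun q _ => (hΘ q ζ).symm
  rw [this]
  refine Submodule.sum_mem _ fun q _ => Submodule.le_topologicalClosure _ ?_
  exact Submodule.subset_span ⟨e q, e q, hΘ q⟩

/-! ### Product systems -/

/-- A product system over `ℤ₊^k` with coefficients in `A`.

The multiplication `X_n × X_m → X_p`, where `n + m = p`, is given on simple tensors. That it
induces an isometry of the completed balanced tensor product `X_n ⊗_A X_m` into `X_p` is the field
`ip_mul`, and that this isometry is onto for nonzero `n`, `m` is the field `dense_mul`.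
Balancedness and the bimodule property are the cases of `mul_assoc` in which one of the degrees is
zero. The fibre `X_0` is identified with the correspondence `A` by `coeff`. -/
structure ProductSystem (k : ℕ) (A : Type u) [NonUnitalCStarAlgebra A] where
  fibre : (Fin k → ℕ) → Type w
  [normedGroup : ∀ n, NormedAddCommGroup (fibre n)]
  [normedSpace : ∀ n, NormedSpace ℂ (fibre n)]
  [corr : ∀ n, CStarCorrespondence A (fibre n)]
  /-- the identification of `A` with `X_0` -/
  coeff : A ≃ₗ[ℂ] fibre 0
  ip_coeff : ∀ a b : A, HilbertModule.ip (coeff a) (coeff b) = star a * b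
  ract_coeff : ∀ a b : A, HilbertModule.ract (coeff a) b = coeff (a * b)
  φ_coeff : ∀ a b : A, CStarCorrespondence.φ a (coeff b) = coeff (a * b)
  mul : ∀ {n m p : Fin k → ℕ}, n + m = p → (fibre n →ₗ[ℂ] fibre m →ₗ[ℂ] fibre p)
  coeff_mul : ∀ {m : Fin k → ℕ} (a : A) (x : fibre m),
    mul (zero_add m) (coeff a) x = CStarCorrespondence.φ a x
  mul_coeff : ∀ {n : Fin k → ℕ} (x : fibre n) (a : A),
    mul (add_zero n) x (coeff a) = HilbertModule.ract x a
  ip_mul : ∀ {n m p : Fin k → ℕ} (h : n + m = p) (x x' : fibre n) (y y' : fibre m),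
    HilbertModule.ip (A := A) (mul h x y) (mul h x' y') =
      HilbertModule.ip y (CStarCorrespondence.φ (HilbertModule.ip (A := A) x x') y')
  dense_mul : ∀ {n m p : Fin k → ℕ} (h : n + m = p), n ≠ 0 → m ≠ 0 →
    (Submodule.span ℂ {z : fibre p | ∃ x y, z = mul h x y}).topologicalClosure = ⊤
  mul_assoc : ∀ {n m l nm ml p : Fin k → ℕ} (h₁ : n + m = nm) (h₂ : nm + l = p)
    (h₃ : m + l = ml) (h₄ : n + ml = p) (x : fibre n) (y : fibre m) (z : fibre l),
    mul h₂ (mul h₁ x y) z = mul h₄ x (mul h₃ y z)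

attribute [instance] ProductSystem.normedGroup ProductSystem.normedSpace ProductSystem.corr

/-- A proper product system: `A` acts on the left of every fibre by compact operators. -/
structure ProperProductSystem (k : ℕ) (A : Type u) [NonUnitalCStarAlgebra A] extends
    ProductSystem.{u, w} k A where
  proper : ∀ (n : Fin k → ℕ) (a : A),
    CStarCorrespondence.φ (E := fibre n) a ∈ compactOperators A (fibre n)

/-- `X_n⁻¹(I) = {a ∈ A | ⟨X_n, a X_n⟩ ⊆ I}`. -/
def ProductSystem.inv {k : ℕ} {A : Type u} [NonUnitalCStarAlgebra A]
    (X : ProductSystem.{u, w} k A) (n : Fin k → ℕ) (I : Set A) : Set A :=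
  {a | ∀ ξ η : X.fibre n, HilbertModule.ip ξ (CStarCorrespondence.φ a η) ∈ I}

/-! ### Ideals, `2^k`-tuples and relative O-families -/

/-- Norm-closed two-sided ideals of a C*-algebra. -/
structure IsClosedIdeal {A : Type u} [NonUnitalCStarAlgebra A] (I : Set A) : Prop where
  zero_mem : 0 ∈ I
  add_mem : ∀ {a b : A}, a ∈ I → b ∈ I → a + b ∈ I
  smul_mem : ∀ (c : ℂ) {a : A}, a ∈ I → c • a ∈ I
  mul_mem_left : ∀ (b : A) {a : A}, a ∈ I → b * a ∈ I
  mul_mem_right : ∀ (b : A) {a : A}, a ∈ I → a * b ∈ I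
  isClosed : IsClosed I

/-- A `2^k`-tuple: a family of non-empty subsets of `A` indexed by the subsets of `[k]`. -/
structure TwoPowTuple (k : ℕ) (A : Type u) where
  set : Finset (Fin k) → Set A
  nonempty : ∀ F, (set F).Nonempty

/-- All the members of the tuple are ideals. -/
def TwoPowTuple.ConsistsOfIdeals {k : ℕ} {A : Type u} [NonUnitalCStarAlgebra A]
    (L : TwoPowTuple k A) : Prop :=
  ∀ F, IsClosedIdeal (L.set F)

/-- T-families of a proper product system. -/
structure IsTFamily {k : ℕ} {A : Type u} [NonUnitalCStarAlgebra A]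
    (X : ProperProductSystem.{u, w} k A) (L : TwoPowTuple k A) : Prop where
  ideals : L.ConsistsOfIdeals
  eq_inter : ∀ (F : Finset (Fin k)) (i : Fin k), i ∉ F →
    L.set F = X.inv (Pi.single i 1) (L.set F) ∩ L.set (insert i F)

/-- `L` is a `K`-relative O-family: a T-family that contains `K`. -/
structure IsRelativeOFamily {k : ℕ} {A : Type u} [NonUnitalCStarAlgebra A]
    (X : ProperProductSystem.{u, w} k A) (K L : TwoPowTuple k A) : Prop where
  isTFamily : IsTFamily X L
  le : ∀ F, K.set F ⊆ L.set F

/-! ### Higher-rank graphs -/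

/-- The structure of a `k`-graph on the category `Λ`. A morphism `f : v ⟶ w` is a path with source
`v` and range `w`, so that the path `λμ` is the morphism `μ ≫ λ`. The vertices are the objects. -/
structure KGraph (k : ℕ) (Λ : Type u) [Category.{v} Λ] where
  countable_obj : Countable Λ
  countable_hom : ∀ v w : Λ, Countable (v ⟶ w)
  /-- the degree functor -/
  deg : ∀ {v w : Λ}, (v ⟶ w) → (Fin k → ℕ)
  deg_id : ∀ v : Λ, deg (𝟙 v) = 0
  deg_comp : ∀ {u v w : Λ} (f : u ⟶ v) (g : v ⟶ w), deg (f ≫ g) = deg g + deg f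
  /-- the factorisation property: every path of degree `m + n` is `μν` for a unique pair of paths
  `μ` of degree `m` and `ν` of degree `n` -/
  factorisation : ∀ {v w : Λ} (f : v ⟶ w) (m n : Fin k → ℕ), deg f = m + n →
    ∃! g : (Σ x : Λ, (v ⟶ x) × (x ⟶ w)), deg g.2.2 = m ∧ deg g.2.1 = n ∧ g.2.1 ≫ g.2.2 = f

namespace KGraph

variable {k : ℕ} {Λ : Type u} [Category.{v} Λ] (G : KGraph k Λ)

/-- `G` is row-finite: `vΛ^n` is finite for every vertex `v` and every degree `n`. -/
def RowFinite : Prop :=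
  ∀ (w : Λ) (n : Fin k → ℕ), {f : Σ v : Λ, (v ⟶ w) | G.deg f.2 = n}.Finite

/-- The set `s(vΛ^n)` of the sources of the paths of degree `n` with range `v`. -/
def sources (v : Λ) (n : Fin k → ℕ) : Set Λ :=
  {x | ∃ f : x ⟶ v, G.deg f = n}

/-- `Λ^n v`, the paths of degree `n` with source `v`. -/
structure PathFrom (n : Fin k → ℕ) (v : Λ) where
  range : Λ
  hom : v ⟶ range
  deg_hom : G.deg hom = n

variable {G}

/-- The path `μν`. -/
def PathFrom.comp {n m p : Fin k → ℕ} (h : n + m = p) {v : Λ} (ν : G.PathFrom m v)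
    (μ : G.PathFrom n ν.range) : G.PathFrom p v :=
  ⟨μ.range, ν.hom ≫ μ.hom, by rw [G.deg_comp, μ.deg_hom, ν.deg_hom, h]⟩

theorem PathFrom.comp_bijective {n m p : Fin k → ℕ} (h : n + m = p) (v : Λ) :
    Function.Bijective
      (fun q : (Σ ν : G.PathFrom m v, G.PathFrom n ν.range) => PathFrom.comp h q.1 q.2) := by
  constructor
  · rintro ⟨⟨x, ν, hν⟩, ⟨y, μ, hμ⟩⟩ ⟨⟨x', ν', hν'⟩, ⟨y', μ', hμ'⟩⟩ e
    simp only at μ μ' hμ hμ'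
    simp only [PathFrom.comp, PathFrom.mk.injEq] at e
    obtain ⟨rfl, e⟩ := e
    have e := eq_of_heq e
    have hd : G.deg (ν ≫ μ) = n + m := by
      rw [G.deg_comp, hν, hμ]
    have := (G.factorisation (ν ≫ μ) n m hd).unique
      (y₁ := ⟨x, ν, μ⟩) (y₂ := ⟨x', ν', μ'⟩) ⟨hμ, hν, rfl⟩ ⟨hμ', hν', e.symm⟩
    simp only [Sigma.mk.injEq] at this
    obtain ⟨rfl, this⟩ := this
    have this := eq_of_heq this
    simp only [Prod.mk.injEq] at this
    obtain ⟨rfl, rfl⟩ := this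
    rfl
  · rintro ⟨y, f, hf⟩
    obtain ⟨⟨x, ν, μ⟩, ⟨h1, h2, h3⟩, -⟩ := G.factorisation f n m (by rw [h]; exact hf)
    refine ⟨⟨⟨x, ν, h2⟩, ⟨y, μ, h1⟩⟩, ?_⟩
    simp only at h3
    subst h3
    rfl

/-- The unique factorisation of the paths of degree `n + m` as a bijection. -/
def PathFrom.compEquiv {n m p : Fin k → ℕ} (h : n + m = p) (v : Λ) :
    (Σ ν : G.PathFrom m v, G.PathFrom n ν.range) ≃ G.PathFrom p v :=
  Equiv.ofBijective _ (PathFrom.comp_bijective h v)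

/-- The vertex `v` as a path of degree `0`. -/
def PathFrom.vertex (v : Λ) : G.PathFrom 0 v := ⟨v, 𝟙 v, G.deg_id v⟩

theorem PathFrom.eq_vertex {v : Λ} (f : G.PathFrom 0 v) : f = PathFrom.vertex v := by
  obtain ⟨w, f, hf⟩ := f
  have := (G.factorisation f 0 0 (by simpa using hf)).unique
    (y₁ := ⟨w, f, 𝟙 w⟩) (y₂ := ⟨v, 𝟙 v, f⟩) ⟨G.deg_id _, hf, by simp⟩ ⟨hf, G.deg_id _, by simp⟩
  have := congrArg (fun g : (Σ x : Λ, (v ⟶ x) × (x ⟶ w)) => (⟨g.1, g.2.1⟩ : Σ x : Λ, (v ⟶ x))) this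
  simp only [Sigma.mk.injEq] at this
  obtain ⟨rfl, this⟩ := this
  have this := eq_of_heq this
  subst this
  rfl

variable (G)

/-- The Hilbert space `ℓ²(Λ^n v)`. -/
abbrev EllTwo (n : Fin k → ℕ) (v : Λ) : Type (max u v) := lp (fun _ : G.PathFrom n v => ℂ) 2

/-- The fibre `X_n(Λ)`, as a space of functions `ξ` on `Λ^n`, where `ξ v` is the restriction of
`ξ` to the paths with source `v`: the functions for which `v ↦ ‖ξ v‖`, the square root of
`∑_{s(λ) = v} |ξ(λ)|²`, vanishes at infinity, with the supremum norm of `v ↦ ‖ξ v‖`. It is complete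
and contains `c_00(Λ^n)` as a dense subspace (`Fibre.dense_span`, `HilbertModule.complete`), i.e.,
it is the completion of `c_00(Λ^n)`. -/
def fibreSubmodule (n : Fin k → ℕ) : Submodule ℂ (lp (fun v : Λ => G.EllTwo n v) ∞) where
  carrier := {ξ | Tendsto (fun v => ‖ξ v‖) cofinite (𝓝 0)}
  zero_mem' := by
    refine (tendsto_const_nhds (x := (0 : ℝ))).congr (fun v => ?_)
    simp
  add_mem' := by
    intro x y hx hy
    refine squeeze_zero (fun _ => norm_nonneg _) (fun v => ?_) (by simpa using hx.add hy)
    exact norm_add_le (x v) (y v)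
  smul_mem' := by
    intro c x hx
    refine (by simpa using hx.const_mul ‖c‖ : Tendsto (fun v => ‖c‖ * ‖x v‖) _ _).congr
      (fun v => ?_)
    simp [norm_smul]

/-- The fibre `X_n(Λ)`. -/
abbrev Fibre (n : Fin k → ℕ) : Type (max u v) := G.fibreSubmodule n

variable {G}

namespace Fibre

variable {n m p : Fin k → ℕ}

theorem ext {ξ η : G.Fibre n} (h : ∀ v f, ξ.1 v f = η.1 v f) : ξ = η := by
  apply Subtype.ext
  apply lp.ext
  funext v
  apply lp.ext
  funext f
  exact h v f

/-- The element of `X_n(Λ)` with given restrictions to the sets `Λ^n v`. -/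
def mk (g : ∀ v, G.EllTwo n v) (hg : Tendsto (fun v => ‖g v‖) cofinite (𝓝 0)) : G.Fibre n :=
  ⟨⟨g, memℓp_infty hg.bddAbove_range_of_cofinite⟩, hg⟩

theorem norm_apply_le (ξ : G.Fibre n) (v : Λ) : ‖ξ.1 v‖ ≤ ‖ξ‖ :=
  lp.norm_apply_le_norm (by simp) ξ.1 v

theorem norm_le {ξ : G.Fibre n} {C : ℝ} (hC : 0 ≤ C) (h : ∀ v, ‖ξ.1 v‖ ≤ C) : ‖ξ‖ ≤ C :=
  lp.norm_le_of_forall_le hC h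

theorem complete : CompleteSpace (G.Fibre n) := by
  apply IsClosed.completeSpace_coe (hs := ?_)
  rw [← isSeqClosed_iff_isClosed]
  intro x ξ hx hlim
  change Tendsto (fun v => ‖ξ v‖) cofinite (𝓝 0)
  rw [Metric.tendsto_nhds]
  intro ε hε
  obtain ⟨N, hN⟩ := (Metric.tendsto_atTop.1 hlim (ε / 2) (half_pos hε))
  have h1 := Metric.tendsto_nhds.1 (show Tendsto (fun v => ‖x N v‖) cofinite (𝓝 0) from hx N)
    (ε / 2) (half_pos hε)
  filter_upwards [h1] with v hv
  have h2 := hN N le_rfl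
  rw [dist_eq_norm] at h2
  have h3 : ‖x N v - ξ v‖ ≤ ‖x N - ξ‖ := lp.norm_apply_le_norm (by simp) (x N - ξ) v
  simp only [dist_zero_right, norm_norm] at hv ⊢
  have h4 : ‖ξ v‖ ≤ ‖x N v‖ + ‖x N v - ξ v‖ := norm_le_insert (x N v) (ξ v)
  linarith

end Fibre

/-- Multiplication by a bounded function on `ℓ²(Λ^n v)`. -/
def ellMul {n : Fin k → ℕ} {v : Λ} (a : G.PathFrom n v → ℂ) (C : ℝ) (ha : ∀ f, ‖a f‖ ≤ C)
    (x : G.EllTwo n v) : G.EllTwo n v :=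
  ⟨fun f => a f * x f, ((lp.memℓp x).const_smul (C : ℂ)).mono' (fun f => by
    have hC : 0 ≤ C := (norm_nonneg _).trans (ha f)
    simp only [norm_mul, Pi.smul_apply, norm_smul, Complex.norm_real, Real.norm_eq_abs,
      abs_of_nonneg hC]
    gcongr
    exact ha f)⟩

theorem norm_ellMul_le {n : Fin k → ℕ} {v : Λ} (a : G.PathFrom n v → ℂ) (C : ℝ) (hC : 0 ≤ C)
    (ha : ∀ f, ‖a f‖ ≤ C) (x : G.EllTwo n v) : ‖ellMul a C ha x‖ ≤ C * ‖x‖ := by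
  have : ‖ellMul a C ha x‖ ≤ ‖(C : ℂ) • x‖ := by
    apply lp.norm_mono (by simp)
    intro f
    simp only [ellMul, norm_mul, lp.coeFn_smul, Pi.smul_apply, norm_smul, Complex.norm_real,
      Real.norm_eq_abs, abs_of_nonneg hC]
    gcongr
    exact ha f
  rwa [norm_smul, Complex.norm_real, Real.norm_eq_abs, abs_of_nonneg hC] at this

section Coefficients

variable [TopologicalSpace Λ] [DiscreteTopology Λ]

/-- Elements of `c_0(Λ^0)` from functions on the discrete space of vertices. -/
def mkC₀ (g : Λ → ℂ) (hg : Tendsto g cofinite (𝓝 0)) : C₀(Λ, ℂ) where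
  toFun := g
  continuous_toFun := continuous_of_discreteTopology
  zero_at_infty' := by rwa [cocompact_eq_cofinite]

/-- The projection `δ_v ∈ c_0(Λ^0)` on `{v}`. -/
def delta (v : Λ) : C₀(Λ, ℂ) :=
  mkC₀ (Set.indicator {v} 1) (by
    apply tendsto_nhds_of_eventually_eq
    filter_upwards [(Set.finite_singleton v).compl_mem_cofinite] with w hw
    exact Set.indicator_of_notMem hw _)

/-- `H_I = {v | δ_v ∈ I}`. -/
def vertexSet (I : Set C₀(Λ, ℂ)) : Set Λ := {v | delta v ∈ I}

theorem norm_coe_le (a : C₀(Λ, ℂ)) (v : Λ) : ‖a v‖ ≤ ‖a‖ :=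
  a.toBCF.norm_coe_le_norm v

theorem norm_le_of_forall (a : C₀(Λ, ℂ)) {C : ℝ} (hC : 0 ≤ C) (h : ∀ v, ‖a v‖ ≤ C) : ‖a‖ ≤ C :=
  (BoundedContinuousFunction.norm_le (f := a.toBCF) hC).2 h

theorem tendsto_coe (a : C₀(Λ, ℂ)) : Tendsto a cofinite (𝓝 0) := by
  rw [← cocompact_eq_cofinite]
  exact a.zero_at_infty'

namespace Fibre

variable {n m p : Fin k → ℕ}

/-- The right action `(ξ a)(λ) = ξ(λ) a(s(λ))`. -/
def ract (ξ : G.Fibre n) (a : C₀(Λ, ℂ)) : G.Fibre n :=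
  mk (fun v => a v • ξ.1 v) (by
    refine squeeze_zero (fun _ => norm_nonneg _) (fun v => ?_)
      (by simpa using (show Tendsto (fun v => ‖ξ.1 v‖) cofinite (𝓝 0) from ξ.2).const_mul ‖a‖)
    rw [norm_smul]
    gcongr
    exact norm_coe_le a v)

/-- The inner product `⟨ξ, η⟩(v) = ∑_{s(λ) = v} conj(ξ(λ)) η(λ)`. -/
def ip (ξ η : G.Fibre n) : C₀(Λ, ℂ) :=
  mkC₀ (fun v => inner ℂ (ξ.1 v) (η.1 v)) (by
    rw [tendsto_zero_iff_norm_tendsto_zero]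
    refine squeeze_zero (fun _ => norm_nonneg _) (fun v => ?_)
      (by simpa using (show Tendsto (fun v => ‖η.1 v‖) cofinite (𝓝 0) from η.2).const_mul ‖ξ‖)
    refine (norm_inner_le_norm _ _).trans ?_
    gcongr
    exact norm_apply_le ξ v)

theorem ip_apply (ξ η : G.Fibre n) (v : Λ) :
    ip ξ η v = ∑' f : G.PathFrom n v, (starRingEnd ℂ) (ξ.1 v f) * η.1 v f := by
  change inner ℂ (ξ.1 v) (η.1 v) = _
  rw [lp.inner_eq_tsum]
  simp [mul_comm]

/-- The left action `(a ξ)(λ) = a(r(λ)) ξ(λ)`. -/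
def lact (a : C₀(Λ, ℂ)) (ξ : G.Fibre n) : G.Fibre n :=
  mk (fun v => ellMul (fun f => a f.range) ‖a‖ (fun _ => norm_coe_le a _) (ξ.1 v)) (by
    refine squeeze_zero (fun _ => norm_nonneg _) (fun v => ?_)
      (by simpa using (show Tendsto (fun v => ‖ξ.1 v‖) cofinite (𝓝 0) from ξ.2).const_mul ‖a‖)
    exact norm_ellMul_le _ _ (norm_nonneg a) _ _)

theorem norm_lact_le (a : C₀(Λ, ℂ)) (ξ : G.Fibre n) : ‖lact a ξ‖ ≤ ‖a‖ * ‖ξ‖ := by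
  refine norm_le (by positivity) (fun v => ?_)
  refine (norm_ellMul_le (fun f => a f.range) ‖a‖ (norm_nonneg a) (fun _ => norm_coe_le a _)
    (ξ.1 v)).trans ?_
  gcongr
  exact norm_apply_le ξ v

/-- The left action as a homomorphism into the bounded operators. -/
def lactHom : C₀(Λ, ℂ) →ₙₐ[ℂ] (G.Fibre n →L[ℂ] G.Fibre n) where
  toFun a := LinearMap.mkContinuous
    { toFun := lact a
      map_add' := fun x y => ext fun v f => mul_add (a f.range) (x.1 v f) (y.1 v f)
      map_smul' := fun c x => ext fun v f => mul_left_comm (a f.range) c (x.1 v f) }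
    ‖a‖ (norm_lact_le a)
  map_smul' c a := by
    ext1 x
    exact ext fun v f => mul_assoc c (a f.range) (x.1 v f)
  map_zero' := by
    ext1 x
    exact ext fun v f => zero_mul (x.1 v f)
  map_add' a b := by
    ext1 x
    exact ext fun v f => add_mul (a f.range) (b f.range) (x.1 v f)
  map_mul' a b := by
    ext1 x
    exact ext fun v f => mul_assoc (a f.range) (b f.range) (x.1 v f)

instance : CStarCorrespondence C₀(Λ, ℂ) (G.Fibre n) where
  complete := complete
  ract := ract
  ip := ip
  add_ract x y a := ext fun v f => mul_add (a v) (x.1 v f) (y.1 v f)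
  ract_add x a b := ext fun v f => add_mul (a v) (b v) (x.1 v f)
  smul_ract c x a := ext fun v f => mul_left_comm (a v) c (x.1 v f)
  ract_smul c x a := ext fun v f => mul_assoc c (a v) (x.1 v f)
  ract_mul x a b := ext fun v f => by
    change (a v * b v) * x.1 v f = b v * (a v * x.1 v f)
    ring
  ip_add_right x y z := by
    ext v
    exact inner_add_right (𝕜 := ℂ) (x.1 v) (y.1 v) (z.1 v)
  ip_smul_right c x y := by
    ext v
    exact inner_smul_right (𝕜 := ℂ) (x.1 v) (y.1 v) c
  ip_ract_right x y a := by
    ext v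
    exact (inner_smul_right (𝕜 := ℂ) (x.1 v) (y.1 v) (a v)).trans (mul_comm _ _)
  star_ip x y := by
    ext v
    exact inner_conj_symm (𝕜 := ℂ) (y.1 v) (x.1 v)
  ip_self_nonneg x := by
    refine ⟨mkC₀ (fun v => (‖x.1 v‖ : ℂ)) ?_, ?_⟩
    · rw [tendsto_zero_iff_norm_tendsto_zero]
      simpa using (show Tendsto (fun v => ‖x.1 v‖) cofinite (𝓝 0) from x.2)
    · ext v
      change inner ℂ (x.1 v) (x.1 v) = (starRingEnd ℂ) (‖x.1 v‖ : ℂ) * (‖x.1 v‖ : ℂ)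
      rw [inner_self_eq_norm_sq_to_K, Complex.conj_ofReal, sq]
      rfl
  norm_sq_eq x := by
    have key : ∀ v, ‖ip x x v‖ = ‖x.1 v‖ ^ 2 := fun v => by
      change ‖inner ℂ (x.1 v) (x.1 v)‖ = _
      rw [inner_self_eq_norm_sq_to_K]
      simp
    apply le_antisymm
    · have : ‖x‖ ≤ √‖ip x x‖ := by
        refine norm_le (Real.sqrt_nonneg _) (fun v => ?_)
        apply Real.le_sqrt_of_sq_le
        rw [← key v]
        exact norm_coe_le _ v
      calc ‖x‖ ^ 2 ≤ √‖ip x x‖ ^ 2 := by gcongr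
        _ = _ := Real.sq_sqrt (norm_nonneg _)
    · refine norm_le_of_forall _ (by positivity) (fun v => ?_)
      rw [key v]
      gcongr
      exact norm_apply_le x v
  φ := lactHom
  φ_adjoint a x y := by
    ext v
    change ip (lact a x) y v = ip x (lact (star a) y) v
    rw [ip_apply, ip_apply]
    refine tsum_congr fun f => ?_
    change (starRingEnd ℂ) (a f.range * x.1 v f) * y.1 v f =
      (starRingEnd ℂ) (x.1 v f) * ((starRingEnd ℂ) (a f.range) * y.1 v f)
    rw [map_mul]
    ring

end Fibre

end Coefficients

namespace Fibre

variable {n m p : Fin k → ℕ}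

theorem summable_sq {v : Λ} (x : G.EllTwo n v) : Summable fun f => ‖x f‖ ^ 2 := by
  simpa using (lp.memℓp x).summable (by simp)

theorem tsum_sq {v : Λ} (x : G.EllTwo n v) : ∑' f, ‖x f‖ ^ 2 = ‖x‖ ^ 2 := by
  simpa using (lp.norm_rpow_eq_tsum (p := 2) (by simp) x).symm

/-- The coefficient function of a product: `(ξη)(μν) = ξ(μ) η(ν)`. -/
def mulCoeff (h : n + m = p) (ξ : G.Fibre n) (η : G.Fibre m) (v : Λ) (f : G.PathFrom p v) : ℂ :=
  ξ.1 _ ((PathFrom.compEquiv h v).symm f).2 * η.1 v ((PathFrom.compEquiv h v).symm f).1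

theorem mulCoeff_comp (h : n + m = p) (ξ : G.Fibre n) (η : G.Fibre m) (v : Λ)
    (q : Σ ν : G.PathFrom m v, G.PathFrom n ν.range) :
    mulCoeff h ξ η v (PathFrom.compEquiv h v q) = ξ.1 _ q.2 * η.1 v q.1 := by
  unfold mulCoeff
  rw [Equiv.symm_apply_apply]

theorem summable_mulCoeff (h : n + m = p) (ξ : G.Fibre n) (η : G.Fibre m) (v : Λ) :
    Summable (fun f => ‖mulCoeff h ξ η v f‖ ^ 2) ∧
      ∑' f, ‖mulCoeff h ξ η v f‖ ^ 2 ≤ (‖ξ‖ * ‖η.1 v‖) ^ 2 := by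
  rw [← (PathFrom.compEquiv h v).summable_iff, ← (PathFrom.compEquiv h v).tsum_eq]
  simp only [Function.comp_def, mulCoeff_comp, norm_mul, mul_pow]
  have hs : ∀ ν : G.PathFrom m v,
      HasSum (fun μ : G.PathFrom n ν.range => ‖ξ.1 ν.range μ‖ ^ 2 * ‖η.1 v ν‖ ^ 2)
        (‖ξ.1 ν.range‖ ^ 2 * ‖η.1 v ν‖ ^ 2) := fun ν => by
    have := (summable_sq (ξ.1 ν.range)).hasSum
    rw [tsum_sq] at this
    exact this.mul_right _
  have hb : ∀ ν : G.PathFrom m v,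
      ‖ξ.1 ν.range‖ ^ 2 * ‖η.1 v ν‖ ^ 2 ≤ ‖ξ‖ ^ 2 * ‖η.1 v ν‖ ^ 2 := fun ν => by
    gcongr
    exact norm_apply_le ξ _
  have h2 : Summable fun ν : G.PathFrom m v => ‖ξ‖ ^ 2 * ‖η.1 v ν‖ ^ 2 :=
    (summable_sq (η.1 v)).mul_left _
  have h3 : Summable fun ν : G.PathFrom m v => ‖ξ.1 ν.range‖ ^ 2 * ‖η.1 v ν‖ ^ 2 :=
    Summable.of_nonneg_of_le (fun _ => by positivity) hb h2
  have h4 : Summable fun q : (Σ ν : G.PathFrom m v, G.PathFrom n ν.range) =>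
      ‖ξ.1 q.1.range q.2‖ ^ 2 * ‖η.1 v q.1‖ ^ 2 := by
    rw [summable_sigma_of_nonneg (fun _ => by positivity)]
    exact ⟨fun ν => (hs ν).summable, by simpa only [(hs _).tsum_eq] using h3⟩
  refine ⟨h4, ?_⟩
  rw [h4.tsum_sigma' (fun ν => (hs ν).summable)]
  simp only [(hs _).tsum_eq]
  refine (h3.tsum_le_tsum hb h2).trans ?_
  rw [tsum_mul_left, tsum_sq]

/-- The restriction of a product to the paths with source `v`. -/
def mulEll (h : n + m = p) (ξ : G.Fibre n) (η : G.Fibre m) (v : Λ) : G.EllTwo p v :=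
  ⟨mulCoeff h ξ η v, memℓp_gen (by simpa using (summable_mulCoeff h ξ η v).1)⟩

theorem norm_mulEll_le (h : n + m = p) (ξ : G.Fibre n) (η : G.Fibre m) (v : Λ) :
    ‖mulEll h ξ η v‖ ≤ ‖ξ‖ * ‖η.1 v‖ := by
  apply le_of_sq_le_sq _ (by positivity)
  rw [← tsum_sq]
  exact (summable_mulCoeff h ξ η v).2

/-- The multiplication `X_n(Λ) × X_m(Λ) → X_{n+m}(Λ)`, given by `(ξη)(μν) = ξ(μ) η(ν)`; in
particular `δ_μ δ_ν` is `δ_{μν}` if `s(μ) = r(ν)` and `0` otherwise. -/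
def mul (h : n + m = p) : G.Fibre n →ₗ[ℂ] G.Fibre m →ₗ[ℂ] G.Fibre p :=
  LinearMap.mk₂ ℂ
    (fun ξ η => mk (mulEll h ξ η) (by
      refine squeeze_zero (fun _ => norm_nonneg _) (norm_mulEll_le h ξ η)
        (by simpa using (show Tendsto (fun v => ‖η.1 v‖) cofinite (𝓝 0) from η.2).const_mul ‖ξ‖)))
    (fun x x' y => ext fun v f => by exact add_mul _ _ _)
    (fun c x y => ext fun v f => by exact mul_assoc _ _ _)
    (fun x y y' => ext fun v f => by exact mul_add _ _ _)
    (fun c x y => ext fun v f => by exact mul_left_comm _ _ _)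

theorem mul_comp (h : n + m = p) (ξ : G.Fibre n) (η : G.Fibre m) (v : Λ) (ν : G.PathFrom m v)
    (μ : G.PathFrom n ν.range) :
    (mul h ξ η).1 v (PathFrom.comp h ν μ) = ξ.1 ν.range μ * η.1 v ν :=
  mulCoeff_comp h ξ η v ⟨ν, μ⟩

theorem exists_comp (h : n + m = p) {v : Λ} (f : G.PathFrom p v) :
    ∃ (ν : G.PathFrom m v) (μ : G.PathFrom n ν.range), f = PathFrom.comp h ν μ := by
  obtain ⟨⟨ν, μ⟩, rfl⟩ := (PathFrom.comp_bijective h v).2 f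
  exact ⟨ν, μ, rfl⟩

theorem mul_assoc' {l nm ml : Fin k → ℕ} (h₁ : n + m = nm) (h₂ : nm + l = p) (h₃ : m + l = ml)
    (h₄ : n + ml = p) (x : G.Fibre n) (y : G.Fibre m) (z : G.Fibre l) :
    mul h₂ (mul h₁ x y) z = mul h₄ x (mul h₃ y z) := by
  refine ext fun v f => ?_
  obtain ⟨g, μ, rfl⟩ := exists_comp h₄ f
  obtain ⟨ν, κ, rfl⟩ := exists_comp h₃ g
  rw [mul_comp, mul_comp]
  have e : PathFrom.comp h₄ (PathFrom.comp h₃ ν κ) μ =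
      PathFrom.comp h₂ ν (PathFrom.comp h₁ κ μ) := by
    simp [PathFrom.comp]
  have e' : (mul h₁ x y).1 ν.range (PathFrom.comp h₁ κ μ) = x.1 _ μ * y.1 _ κ :=
    mul_comp h₁ x y _ κ μ
  rw [e, mul_comp]
  exact (congrArg (· * z.1 v ν) e').trans (mul_assoc _ _ _)

open Classical in
/-- The generator `δ_λ` of `c_00(Λ^n)`, for a path `λ` of degree `n`. -/
def pathVec (q : Σ v : Λ, G.PathFrom n v) : G.Fibre n :=
  mk (Pi.single q.1 (lp.single 2 q.2 (1 : ℂ))) (by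
    apply tendsto_nhds_of_eventually_eq
    filter_upwards [(Set.finite_singleton q.1).compl_mem_cofinite] with w hw
    rw [Pi.single_eq_of_ne hw, norm_zero])

open Classical in
theorem pathVec_apply (q : Σ v : Λ, G.PathFrom n v) (v : Λ) (f : G.PathFrom n v) :
    (pathVec q).1 v f = if q = ⟨v, f⟩ then 1 else 0 := by
  obtain ⟨w, g⟩ := q
  change (Pi.single (M := fun v => G.EllTwo n v) w (lp.single 2 g (1 : ℂ)) v) f = _
  by_cases hw : w = v
  · subst hw
    rw [Pi.single_eq_same, lp.single_apply]
    by_cases hf : f = g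
    · subst hf; simp
    · rw [Pi.single_eq_of_ne hf, if_neg]
      simpa using fun h => hf h.symm
  · rw [Pi.single_eq_of_ne (Ne.symm hw), if_neg]
    · rfl
    · intro h; exact hw (congrArg Sigma.fst h)

open Classical in
/-- The inclusion of `ℓ²(Λ^n v)` into `X_n(Λ)`. -/
def incl (v : Λ) : G.EllTwo n v →L[ℂ] G.Fibre n :=
  LinearMap.mkContinuous
    { toFun := fun x => mk (Pi.single v x) (by
        apply tendsto_nhds_of_eventually_eq
        filter_upwards [(Set.finite_singleton v).compl_mem_cofinite] with w hw
        rw [Pi.single_eq_of_ne hw, norm_zero])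
      map_add' := fun x y => by
        apply Subtype.ext
        apply lp.ext
        exact Pi.single_add v x y
      map_smul' := fun c x => by
        apply Subtype.ext
        apply lp.ext
        exact Pi.single_smul v c x }
    1 (fun x => by
      refine norm_le (by positivity) (fun w => ?_)
      change ‖(Pi.single v x : ∀ v, G.EllTwo n v) w‖ ≤ _
      by_cases hw : w = v
      · subst hw; simp
      · rw [Pi.single_eq_of_ne hw, norm_zero]; positivity)

open Classical in
/-- `c_00(Λ^n)` is dense in `X_n(Λ)`. -/
theorem dense_span :
    (Submodule.span ℂ (Set.range (pathVec (G := G) (n := n)))).topologicalClosure = ⊤ := by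
  set S := (Submodule.span ℂ (Set.range (pathVec (G := G) (n := n)))).topologicalClosure with hS
  have hSc : IsClosed (S : Set (G.Fibre n)) := Submodule.isClosed_topologicalClosure _
  have h1 : ∀ (v : Λ) (x : G.EllTwo n v), incl v x ∈ S := by
    intro v x
    have hx := (lp.hasSum_single (p := 2) (by simp) x).mapL (incl v)
    refine hSc.mem_of_tendsto hx (Eventually.of_forall fun s => Submodule.sum_mem _ fun f _ => ?_)
    have : lp.single (E := fun _ : G.PathFrom n v => ℂ) 2 f (x f) = x f • lp.single 2 f (1 : ℂ) := by
      rw [← lp.single_smul]; simp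
    rw [this, map_smul]
    apply Submodule.smul_mem
    apply Submodule.le_topologicalClosure
    exact Submodule.subset_span ⟨⟨v, f⟩, rfl⟩
  rw [eq_top_iff]
  rintro x -
  change x ∈ (S : Set (G.Fibre n))
  rw [← hSc.closure_eq, Metric.mem_closure_iff]
  intro ε hε
  have hfin := Metric.tendsto_nhds.1 (show Tendsto (fun v => ‖x.1 v‖) cofinite (𝓝 0) from x.2)
    (ε / 2) (half_pos hε)
  rw [Filter.eventually_cofinite] at hfin
  refine ⟨∑ v ∈ hfin.toFinset, incl v (x.1 v), Submodule.sum_mem _ fun v _ => h1 v _, ?_⟩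
  rw [dist_eq_norm]
  refine (norm_le (half_pos hε).le fun v => ?_).trans_lt (half_lt_self hε)
  have h2 : (x - ∑ v ∈ hfin.toFinset, incl v (x.1 v)).1 v =
      x.1 v - ∑ w ∈ hfin.toFinset, (Pi.single w (x.1 w) : ∀ v, G.EllTwo n v) v := by
    rw [AddSubgroupClass.coe_sub, AddSubmonoidClass.coe_finsetSum, lp.coeFn_sub, Pi.sub_apply,
      lp.coeFn_sum, Finset.sum_apply]
    rfl
  rw [h2, Finset.sum_pi_single]
  split_ifs with hv
  · simpa using (half_pos hε).le
  · simp only [Set.Finite.mem_toFinset, Set.mem_ofPred_eq, not_not, dist_zero_right,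
      norm_norm] at hv
    simpa using hv.le

theorem mul_pathVec (h : n + m = p) {v : Λ} (ν : G.PathFrom m v) (μ : G.PathFrom n ν.range) :
    mul h (pathVec ⟨ν.range, μ⟩) (pathVec ⟨v, ν⟩) = pathVec ⟨v, PathFrom.comp h ν μ⟩ := by
  refine ext fun w f => ?_
  obtain ⟨ν', μ', rfl⟩ := exists_comp h f
  rw [mul_comp, pathVec_apply, pathVec_apply, pathVec_apply]
  by_cases hw : v = w
  · subst hw
    have hc : PathFrom.comp h ν μ = PathFrom.comp h ν' μ' ↔
        (⟨ν, μ⟩ : Σ ν : G.PathFrom m v, G.PathFrom n ν.range) = ⟨ν', μ'⟩ :=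
      (PathFrom.comp_bijective h v).1.eq_iff (a := ⟨ν, μ⟩) (b := ⟨ν', μ'⟩)
    by_cases hν : ν = ν'
    · subst hν
      by_cases hμ : μ = μ'
      · subst hμ
        simp
      · rw [if_neg (c := (⟨ν.range, μ⟩ : Σ v : Λ, G.PathFrom n v) = _),
          if_neg (c := (⟨v, PathFrom.comp h ν μ⟩ : Σ v : Λ, G.PathFrom p v) = _)]
        · simp
        · intro e
          have e1 : PathFrom.comp h ν μ = PathFrom.comp h ν μ' := eq_of_heq (Sigma.mk.inj e).2
          exact hμ (eq_of_heq (Sigma.mk.inj (hc.1 e1)).2)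
        · intro e
          exact hμ (eq_of_heq (Sigma.mk.inj e).2)
    · rw [if_neg (c := (⟨v, ν⟩ : Σ v : Λ, G.PathFrom m v) = _), if_neg (c := _ = Sigma.mk v _)]
      · simp
      · simp [hc, hν]
      · simp [hν]
  · rw [if_neg (c := (⟨v, ν⟩ : Σ v : Λ, G.PathFrom m v) = _), if_neg (c := _ = Sigma.mk w _)]
    · simp
    · intro e; exact hw (congrArg Sigma.fst e)
    · intro e; exact hw (congrArg Sigma.fst e)

theorem dense_mul (h : n + m = p) :
    (Submodule.span ℂ {z : G.Fibre p | ∃ x y, z = mul h x y}).topologicalClosure = ⊤ := by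
  rw [eq_top_iff, ← dense_span]
  apply Submodule.topologicalClosure_mono
  rw [Submodule.span_le]
  rintro - ⟨⟨v, f⟩, rfl⟩
  obtain ⟨ν, μ, rfl⟩ := exists_comp h f
  exact Submodule.subset_span ⟨_, _, (mul_pathVec h ν μ).symm⟩

variable [TopologicalSpace Λ] [DiscreteTopology Λ]

theorem ip_mul (h : n + m = p) (x x' : G.Fibre n) (y y' : G.Fibre m) :
    ip (mul h x y) (mul h x' y') = ip y (lact (ip x x') y') := by
  ext v
  rw [ip_apply, ip_apply]
  have hs := lp.summable_inner (𝕜 := ℂ) ((mul h x y).1 v) ((mul h x' y').1 v)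
  have hs : Summable fun f => (starRingEnd ℂ) ((mul h x y).1 v f) * (mul h x' y').1 v f := by
    simpa [mul_comm] using hs
  rw [← (PathFrom.compEquiv h v).tsum_eq]
  rw [← (PathFrom.compEquiv h v).summable_iff] at hs
  have hs1 : ∀ ν : G.PathFrom m v, Summable fun μ : G.PathFrom n ν.range =>
      (starRingEnd ℂ) (x.1 _ μ) * x'.1 _ μ := fun ν => by
    simpa [mul_comm] using lp.summable_inner (𝕜 := ℂ) (x.1 ν.range) (x'.1 ν.range)
  have key : ∀ (ν : G.PathFrom m v) (μ : G.PathFrom n ν.range),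
      (starRingEnd ℂ) ((mul h x y).1 v (PathFrom.compEquiv h v ⟨ν, μ⟩)) *
        (mul h x' y').1 v (PathFrom.compEquiv h v ⟨ν, μ⟩) =
      ((starRingEnd ℂ) (x.1 _ μ) * x'.1 _ μ) * ((starRingEnd ℂ) (y.1 v ν) * y'.1 v ν) := by
    intro ν μ
    change (starRingEnd ℂ) ((mul h x y).1 v (PathFrom.comp h ν μ)) *
        (mul h x' y').1 v (PathFrom.comp h ν μ) = _
    rw [mul_comp, mul_comp, map_mul]
    ring
  refine (Summable.tsum_sigma' ?_ hs).trans ?_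
  rotate_left
  · refine tsum_congr fun ν => ?_
    refine (tsum_congr (key ν)).trans ?_
    rw [tsum_mul_right, ← ip_apply]
    change _ = (starRingEnd ℂ) (y.1 v ν) * (ip x x' ν.range * y'.1 v ν)
    ring
  · intro ν
    exact ((hs1 ν).mul_right _).congr (fun μ => (key ν μ).symm)

open Classical in
/-- The identification of `c_0(Λ^0)` with `X_0(Λ)`. -/
def coeff : C₀(Λ, ℂ) ≃ₗ[ℂ] G.Fibre 0 where
  toFun a := mk (fun v => a v • lp.single 2 (PathFrom.vertex v) (1 : ℂ)) (by
    simpa [norm_smul, lp.norm_single] using (tendsto_coe a).norm)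
  map_add' a b := by
    apply Subtype.ext
    apply lp.ext
    funext v
    exact add_smul (a v) (b v) _
  map_smul' c a := by
    apply Subtype.ext
    apply lp.ext
    funext v
    exact mul_smul c (a v) _
  invFun x := mkC₀ (fun v => x.1 v (PathFrom.vertex v)) (by
    rw [tendsto_zero_iff_norm_tendsto_zero]
    exact squeeze_zero (fun _ => norm_nonneg _)
      (fun v => lp.norm_apply_le_norm (by simp) (x.1 v) (PathFrom.vertex v)) x.2)
  left_inv a := by
    ext v
    change a v • (lp.single (E := fun _ : G.PathFrom 0 v => ℂ) 2 (PathFrom.vertex v) (1 : ℂ))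
      (PathFrom.vertex v) = a v
    simp
  right_inv x := by
    refine ext fun v f => ?_
    obtain rfl := f.eq_vertex
    change x.1 v (PathFrom.vertex v) •
      (lp.single (E := fun _ : G.PathFrom 0 v => ℂ) 2 (PathFrom.vertex v) (1 : ℂ))
      (PathFrom.vertex v) = x.1 v (PathFrom.vertex v)
    simp

open Classical in
theorem coeff_apply (a : C₀(Λ, ℂ)) (v : Λ) (f : G.PathFrom 0 v) : (coeff a).1 v f = a v := by
  obtain rfl := f.eq_vertex
  change a v • (lp.single (E := fun _ : G.PathFrom 0 v => ℂ) 2 (PathFrom.vertex v) (1 : ℂ))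
      (PathFrom.vertex v) = a v
  simp

end Fibre

variable [TopologicalSpace Λ] [DiscreteTopology Λ]

variable (G) in
/-- The product system `X(Λ)`. -/
def productSystem : ProductSystem.{u, max u v} k C₀(Λ, ℂ) where
  fibre := G.Fibre
  coeff := Fibre.coeff
  ip_coeff a b := by
    ext v
    refine (Fibre.ip_apply _ _ v).trans ?_
    simp only [Fibre.coeff_apply]
    rw [tsum_eq_single (PathFrom.vertex v) (fun f hf => absurd f.eq_vertex hf)]
    rfl
  ract_coeff a b := Fibre.ext fun v f => by
    refine Eq.trans ?_ (Fibre.coeff_apply _ v f).symm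
    change b v * (Fibre.coeff a).1 v f = a v * b v
    rw [Fibre.coeff_apply, mul_comm]
  φ_coeff a b := Fibre.ext fun v f => by
    refine Eq.trans ?_ (Fibre.coeff_apply _ v f).symm
    change a f.range * (Fibre.coeff b).1 v f = a v * b v
    rw [Fibre.coeff_apply]
    obtain rfl := f.eq_vertex
    rfl
  mul := Fibre.mul
  coeff_mul a x := Fibre.ext fun v f => by
    obtain ⟨ν, μ, rfl⟩ := Fibre.exists_comp (zero_add _) f
    rw [Fibre.mul_comp, Fibre.coeff_apply]
    change _ = a μ.range * x.1 v _
    obtain rfl := μ.eq_vertex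
    have : PathFrom.comp (zero_add _) ν (PathFrom.vertex ν.range) = ν := by
      simp [PathFrom.comp, PathFrom.vertex]
    rw [this]
    rfl
  mul_coeff x a := Fibre.ext fun v f => by
    obtain ⟨ν, μ, rfl⟩ := Fibre.exists_comp (add_zero _) f
    rw [Fibre.mul_comp, Fibre.coeff_apply]
    change _ = a v * x.1 v _
    obtain rfl := ν.eq_vertex
    have : PathFrom.comp (add_zero _) (PathFrom.vertex v) μ = μ := by
      simp [PathFrom.comp, PathFrom.vertex]
      rfl
    rw [this, mul_comm]
    rfl
  ip_mul := Fibre.ip_mul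
  dense_mul h _ _ := Fibre.dense_mul h
  mul_assoc := Fibre.mul_assoc'

theorem span_delta : (Submodule.span ℂ (Set.range (delta (Λ := Λ)))).topologicalClosure = ⊤ := by
  set S := (Submodule.span ℂ (Set.range (delta (Λ := Λ)))).topologicalClosure with hS
  have hSc : IsClosed (S : Set C₀(Λ, ℂ)) := Submodule.isClosed_topologicalClosure _
  rw [eq_top_iff]
  rintro a -
  change a ∈ (S : Set C₀(Λ, ℂ))
  rw [← hSc.closure_eq, Metric.mem_closure_iff]
  intro ε hε
  have hfin := Metric.tendsto_nhds.1 (tendsto_coe a) (ε / 2) (half_pos hε)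
  rw [Filter.eventually_cofinite] at hfin
  refine ⟨∑ v ∈ hfin.toFinset, a v • delta v, Submodule.sum_mem _ fun v _ =>
    Submodule.smul_mem _ _ (Submodule.le_topologicalClosure _ (Submodule.subset_span ⟨v, rfl⟩)), ?_⟩
  rw [dist_eq_norm]
  refine (norm_le_of_forall _ (half_pos hε).le fun v => ?_).trans_lt (half_lt_self hε)
  classical
  have h0 : ∀ T : Finset Λ, (∑ w ∈ T, a w • delta w : C₀(Λ, ℂ)) v =
      ∑ w ∈ T, if v = w then a w else 0 := by
    intro T
    induction T using Finset.induction_on with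
    | empty => simp
    | insert w T hw ih =>
      rw [Finset.sum_insert hw, Finset.sum_insert hw, ← ih]
      change a w • (Set.indicator {w} (1 : Λ → ℂ) v) + _ = _
      simp [Set.indicator_apply]
  rw [ZeroAtInftyContinuousMap.sub_apply, h0, Finset.sum_ite_eq]
  split_ifs with hv
  · simpa using (half_pos hε).le
  · simp only [Set.Finite.mem_toFinset, Set.mem_ofPred_eq, not_not, dist_zero_right] at hv
    simpa using hv.le

theorem Fibre.coord_le {n : Fin k → ℕ} (q : Σ w : Λ, G.PathFrom n w) (ζ : G.Fibre n) :
    ‖ζ.1 q.1 q.2‖ ≤ ‖ζ‖ :=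
  (lp.norm_apply_le_norm (by simp) (ζ.1 q.1) q.2).trans (Fibre.norm_apply_le ζ q.1)

theorem Fibre.sum_coord {n : Fin k → ℕ} {ι : Type*} (T : Finset ι) (x : ι → G.Fibre n) (w : Λ)
    (f : G.PathFrom n w) : (∑ q ∈ T, x q).1 w f = ∑ q ∈ T, (x q).1 w f := by
  classical
  induction T using Finset.induction_on with
  | empty => rfl
  | insert q T hq ih =>
    rw [Finset.sum_insert hq, Finset.sum_insert hq, ← ih]
    rfl

/-- The operator `ζ ↦ ζ(λ) δ_λ`. -/
def Fibre.coordProj {n : Fin k → ℕ} (q : Σ w : Λ, G.PathFrom n w) : G.Fibre n →L[ℂ] G.Fibre n :=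
  LinearMap.mkContinuous
    { toFun := fun ζ => ζ.1 q.1 q.2 • Fibre.pathVec q
      map_add' := fun ζ ζ' => add_smul (ζ.1 q.1 q.2) (ζ'.1 q.1 q.2) _
      map_smul' := fun c ζ => mul_smul c (ζ.1 q.1 q.2) _ } ‖Fibre.pathVec q‖ (fun ζ => by
    change ‖ζ.1 q.1 q.2 • Fibre.pathVec q‖ ≤ _
    rw [norm_smul, mul_comm]
    gcongr
    exact Fibre.coord_le q ζ)

theorem Fibre.coordProj_eq {n : Fin k → ℕ} (q : Σ w : Λ, G.PathFrom n w) (ζ : G.Fibre n) :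
    Fibre.coordProj q ζ = Fibre.ract (Fibre.pathVec q) (Fibre.ip (Fibre.pathVec q) ζ) := by
  classical
  refine Fibre.ext fun w f => ?_
  change ζ.1 q.1 q.2 * (Fibre.pathVec q).1 w f =
    Fibre.ip (Fibre.pathVec q) ζ w * (Fibre.pathVec q).1 w f
  rw [Fibre.pathVec_apply]
  split_ifs with h
  · subst h
    rw [Fibre.ip_apply, tsum_eq_single f]
    · simp [Fibre.pathVec_apply]
    · intro g hg
      rw [Fibre.pathVec_apply, if_neg]
      · simp
      · simpa using fun h => hg h.symm
  · simp

theorem lact_delta_eq {n : Fin k → ℕ} {v : Λ}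
    (hfin : {q : Σ w : Λ, G.PathFrom n w | q.2.range = v}.Finite) (ζ : G.Fibre n) :
    Fibre.lact (delta v) ζ = ∑ q ∈ hfin.toFinset,
      Fibre.ract (Fibre.pathVec q) (Fibre.ip (Fibre.pathVec q) ζ) := by
  classical
  refine Fibre.ext fun w f => ?_
  rw [Fibre.sum_coord]
  have h0 : ∀ q ∈ hfin.toFinset,
      (Fibre.ract (Fibre.pathVec q) (Fibre.ip (Fibre.pathVec q) ζ)).1 w f =
        if q = ⟨w, f⟩ then ζ.1 q.1 q.2 else 0 := by
    intro q _
    rw [← Fibre.coordProj_eq]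
    change ζ.1 q.1 q.2 * (Fibre.pathVec q).1 w f = _
    rw [Fibre.pathVec_apply, mul_ite, mul_one, mul_zero]
  rw [Finset.sum_congr rfl h0, Finset.sum_ite_eq']
  change Set.indicator {v} (1 : Λ → ℂ) f.range * ζ.1 w f = _
  by_cases hf : f.range = v
  · simp [hf]
  · simp [hf]

theorem lact_mem_compactOperators (hG : G.RowFinite) (n : Fin k → ℕ) (a : C₀(Λ, ℂ)) :
    CStarCorrespondence.φ (E := G.Fibre n) a ∈ compactOperators C₀(Λ, ℂ) (G.Fibre n) := by
  refine φ_mem_compactOperators (A := C₀(Λ, ℂ)) (E := G.Fibre n) span_delta ?_ ?_ a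
  · intro b x
    exact Fibre.norm_lact_le b x
  rintro - ⟨v, rfl⟩
  have hfin : {q : Σ w : Λ, G.PathFrom n w | q.2.range = v}.Finite := by
    have := (hG v n).to_subtype
    refine (Set.finite_range (fun f : {f : Σ u : Λ, (u ⟶ v) | G.deg f.2 = n} =>
      (⟨f.1.1, ⟨v, f.1.2, f.2⟩⟩ : Σ w : Λ, G.PathFrom n w))).subset ?_
    rintro ⟨w, ⟨x, f, hf⟩⟩ rfl
    exact ⟨⟨⟨w, f⟩, hf⟩, rfl⟩
  exact mem_compactOperators_of_sum hfin.toFinset _ Fibre.coordProj Fibre.pathVec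
    Fibre.coordProj_eq (lact_delta_eq hfin)

variable (G) in
/-- The product system `X(Λ)` of a row-finite `k`-graph, as a proper product system. -/
def properProductSystem (hG : G.RowFinite) : ProperProductSystem.{u, max u v} k C₀(Λ, ℂ) where
  toProductSystem := G.productSystem
  proper := lact_mem_compactOperators hG

end KGraph

end

namespace KGraph

variable {Λ : Type u} [TopologicalSpace Λ] [DiscreteTopology Λ]

/-! Since `Λ` is discrete, a closed ideal `I` of `c_0(Λ^0)` is determined by its vertex set `H_I`:
it consists of the functions supported in `H_I` (`mem_iff_support_subset_vertexSet`). If `a ∈ I` and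
`a(v) ≠ 0`, then `δ_v = a(v)⁻¹ δ_v a` lies in `I`; conversely, `a` is a norm limit of finite
combinations of the `δ_v` with `a(v) ≠ 0`. Inclusions of closed ideals are thus inclusions of vertex
sets, and this turns `K_F ⊆ L_F` into (iii).

For (ii), the ideal `X_n⁻¹(I)` has to be described in the same way (`mem_inv_iff`). The value of
`⟨ξ, aη⟩` at `x` is the sum of `conj(ξ(λ)) a(r(λ)) η(λ)` over the paths `λ` of degree `n` with `s(λ)
= x`. It therefore sees `a` only at the ranges of such paths, and `ξ = η = δ_λ` isolates the single
value `a(r(λ))`. So `a ∈ X_n⁻¹(I)` exactly when every path of degree `n` whose range is in the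
support of `a` has its source in `H_I`.

All the memberships involved are now conditions on the individual points of the support, so the
equation `I = X_n⁻¹(I) ∩ J` can be checked vertex by vertex (`eq_inv_inter_iff`). -/

theorem delta_apply_self (v : Λ) : delta v v = 1 := by
  change Set.indicator {v} (1 : Λ → ℂ) v = 1
  simp

theorem delta_apply_of_ne {v w : Λ} (h : w ≠ v) : delta v w = 0 :=
  Set.indicator_of_notMem (show w ∉ ({v} : Set Λ) from h) _

/-- `δ_v` is a minimal projection. An ideal that contains some `a` with `a(v) ≠ 0` is thereby forced
to contain `δ_v`. -/
theorem delta_mul (v : Λ) (a : C₀(Λ, ℂ)) : delta v * a = a v • delta v := by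
  ext w
  change delta v w * a w = a v * delta v w
  by_cases h : w = v
  · subst h
    exact mul_comm _ _
  · simp [delta_apply_of_ne h]

variable {k : ℕ} [Category.{v} Λ] {G : KGraph k Λ}

/-! ### Closed ideals of `c_0(Λ^0)` and their vertex sets. -/

/-- Every element of `c_0(Λ^0)` is a limit of combinations of the `δ_v`, with `v` in its support. -/
theorem mem_closure_span_delta (a : C₀(Λ, ℂ)) :
    a ∈ (Submodule.span ℂ (delta '' {v : Λ | a v ≠ 0})).topologicalClosure := by
  set S := Submodule.span ℂ (delta '' {v : Λ | a v ≠ 0}) with hS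
  change a ∈ closure (S : Set C₀(Λ, ℂ))
  rw [Metric.mem_closure_iff]
  intro ε hε
  have hfin := Metric.tendsto_nhds.1 (tendsto_coe a) (ε / 2) (half_pos hε)
  rw [Filter.eventually_cofinite] at hfin
  -- The approximant is the restriction of `a` to the finite set where `|a(v)| ≥ ε/2`. The pointwise
  -- estimates only give `≤` for the supremum norm, and `ε/2` makes the final inequality strict.
  refine ⟨∑ v ∈ hfin.toFinset, a v • delta v, Submodule.sum_mem _ fun v _ => ?_, ?_⟩
  · by_cases hv : a v = 0
    · rw [hv, zero_smul]
      exact Submodule.zero_mem _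
    · exact Submodule.smul_mem _ _ (Submodule.subset_span ⟨v, hv, rfl⟩)
  rw [dist_eq_norm]
  refine (norm_le_of_forall _ (half_pos hε).le fun v => ?_).trans_lt (half_lt_self hε)
  classical
  -- Evaluation at `v` is moved inside the sum. The index set is a general `T`, so that one can
  -- induct on it.
  have hsum : ∀ T : Finset Λ, (∑ w ∈ T, a w • delta w : C₀(Λ, ℂ)) v =
      ∑ w ∈ T, if v = w then a w else 0 := by
    intro T
    induction T using Finset.induction_on with
    | empty => simp
    | insert w T hw ih =>
      rw [Finset.sum_insert hw, Finset.sum_insert hw, ← ih]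
      change a w • (Set.indicator {w} (1 : Λ → ℂ) v) + _ = _
      simp [Set.indicator_apply]
  rw [ZeroAtInftyContinuousMap.sub_apply, hsum, Finset.sum_ite_eq]
  split_ifs with hv
  · simpa using (half_pos hε).le
  · simp only [Set.Finite.mem_toFinset, Set.mem_ofPred_eq, not_not, dist_zero_right] at hv
    simpa using hv.le

/-- A closed ideal of `c_0(Λ^0)` consists of the functions supported in its vertex set. -/
theorem mem_iff_support_subset_vertexSet {I : Set C₀(Λ, ℂ)} (hI : IsClosedIdeal I)
    (a : C₀(Λ, ℂ)) : a ∈ I ↔ ∀ v, a v ≠ 0 → v ∈ vertexSet I := by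
  constructor
  · intro ha v hv
    -- The element `a(v)⁻¹ δ_v a` of `I` is `δ_v` itself.
    have h := hI.smul_mem (a v)⁻¹ (hI.mul_mem_left (delta v) ha)
    rwa [delta_mul, smul_smul, inv_mul_cancel₀ hv, one_smul] at h
  · intro h
    -- `I` is viewed as a closed subspace: it contains the `δ_v` with `a(v) ≠ 0`, hence their closed
    -- span, hence `a`.
    let J : Submodule ℂ C₀(Λ, ℂ) :=
      { carrier := I
        zero_mem' := hI.zero_mem
        add_mem' := hI.add_mem
        smul_mem' := fun c _ => hI.smul_mem c }
    have hJ : Submodule.span ℂ (delta '' {v : Λ | a v ≠ 0}) ≤ J := by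
      rw [Submodule.span_le]
      rintro - ⟨v, hv, rfl⟩
      exact h v hv
    exact Submodule.topologicalClosure_minimal _ hJ hI.isClosed (mem_closure_span_delta a)

/-- One direction tests the inclusion on the `δ_v`; the other compares supports. -/
theorem subset_iff_vertexSet_subset {I J : Set C₀(Λ, ℂ)} (hI : IsClosedIdeal I)
    (hJ : IsClosedIdeal J) : I ⊆ J ↔ vertexSet I ⊆ vertexSet J := by
  constructor
  · exact fun h v hv => h hv
  · intro h a ha
    rw [mem_iff_support_subset_vertexSet hJ]
    exact fun v hv => h ((mem_iff_support_subset_vertexSet hI a).1 ha v hv)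

/-! ### The sets `X_n⁻¹(I)` in terms of paths. -/

/-- Only `λ` itself contributes to the sum over the paths with source `v`. The pairing transports
the value of `a` from the range of a path to its source. -/
theorem ip_pathVec_lact (a : C₀(Λ, ℂ)) {n : Fin k → ℕ} {v : Λ} (f : G.PathFrom n v) :
    Fibre.ip (Fibre.pathVec ⟨v, f⟩) (Fibre.lact a (Fibre.pathVec ⟨v, f⟩)) v = a f.range := by
  classical
  rw [Fibre.ip_apply, tsum_eq_single f]
  · change (starRingEnd ℂ) ((Fibre.pathVec ⟨v, f⟩).1 v f) *
      (a f.range * (Fibre.pathVec ⟨v, f⟩).1 v f) = _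
    simp [Fibre.pathVec_apply]
  · intro g hg
    rw [Fibre.pathVec_apply, if_neg]
    · simp
    · simpa using fun h => hg h.symm

/-- For a closed ideal `I`, the set `X_n⁻¹(I)` consists of the functions supported in
`{v | s(vΛ^n) ⊆ H_I}`. -/
theorem mem_inv_iff {I : Set C₀(Λ, ℂ)} (hI : IsClosedIdeal I) (n : Fin k → ℕ) (a : C₀(Λ, ℂ)) :
    a ∈ G.productSystem.inv n I ↔ ∀ v, a v ≠ 0 → G.sources v n ⊆ vertexSet I := by
  constructor
  · rintro ha v hv x ⟨f, hf⟩
    let q : G.PathFrom n x := ⟨v, f, hf⟩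
    -- For the path `λ = q` from `x` to `v`, the element `⟨δ_λ, a δ_λ⟩` of `I` takes the value `a(v)
    -- ≠ 0` at `x`, so `x ∈ H_I`.
    refine (mem_iff_support_subset_vertexSet hI _).1
      (ha (Fibre.pathVec ⟨x, q⟩) (Fibre.pathVec ⟨x, q⟩)) x ?_
    change Fibre.ip (Fibre.pathVec ⟨x, q⟩) (Fibre.lact a (Fibre.pathVec ⟨x, q⟩)) x ≠ 0
    rw [ip_pathVec_lact]
    exact hv
  · intro h (ξ : G.Fibre n) (η : G.Fibre n)
    refine (mem_iff_support_subset_vertexSet hI _).2 fun x hx => ?_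
    change Fibre.ip (n := n) ξ (Fibre.lact a η) x ≠ 0 at hx
    rw [Fibre.ip_apply] at hx
    -- If `x ∉ H_I`, then `a` vanishes at the range of every path of degree `n` with source `x`, so
    -- the sum is zero term by term.
    by_contra hxI
    refine hx ((tsum_congr fun f => ?_).trans tsum_zero)
    have haf : a f.range = 0 := by
      by_contra haf
      exact hxI (h f.range haf ⟨f.hom, f.deg_hom⟩)
    change _ * (a f.range * _) = _
    rw [haf, zero_mul, mul_zero]

/-- The support of `δ_v` is `{v}`. This computes the vertex set of `X_n⁻¹(I)` without first showing
that `X_n⁻¹(I)` is a closed ideal. -/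
theorem delta_mem_inv_iff {I : Set C₀(Λ, ℂ)} (hI : IsClosedIdeal I) (n : Fin k → ℕ) (v : Λ) :
    delta v ∈ G.productSystem.inv n I ↔ G.sources v n ⊆ vertexSet I := by
  rw [mem_inv_iff hI]
  constructor
  · intro h
    exact h v (by rw [delta_apply_self]; exact one_ne_zero)
  · intro h w hw
    obtain rfl : w = v := by
      by_contra hne
      exact hw (delta_apply_of_ne hne)
    exact h

/-- This is the passage between the T-family equation and condition (ii), for `J = L_{F ∪ {i}}` and
`n` a generator. -/
theorem eq_inv_inter_iff {I J : Set C₀(Λ, ℂ)} (hI : IsClosedIdeal I) (hJ : IsClosedIdeal J)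
    (n : Fin k → ℕ) :
    I = G.productSystem.inv n I ∩ J ↔
      vertexSet I = {v : Λ | G.sources v n ⊆ vertexSet I} ∩ vertexSet J := by
  constructor
  · intro h
    ext v
    have hv := Set.ext_iff.1 h (delta v)
    rw [Set.mem_inter_iff, delta_mem_inv_iff hI] at hv
    exact hv
  · intro h
    ext a
    -- Both sides become statements about all `v` with `a(v) ≠ 0`; `forall₂_and` merges the two on
    -- the right, and what remains is the equality of vertex sets at `v`.
    rw [Set.mem_inter_iff, mem_inv_iff hI, mem_iff_support_subset_vertexSet hI,
      mem_iff_support_subset_vertexSet hJ, ← forall₂_and]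
    exact forall₂_congr fun v _ => Set.ext_iff.1 h v

end KGraph

theorem corollaryD {k : ℕ} {Λ : Type u} [Category.{v} Λ] [TopologicalSpace Λ] [DiscreteTopology Λ]
    (G : KGraph k Λ) (hG : G.RowFinite) (K L : TwoPowTuple k C₀(Λ, ℂ))
    (hK : K.ConsistsOfIdeals) :
    IsRelativeOFamily (G.properProductSystem hG) K L ↔
      L.ConsistsOfIdeals ∧
      (∀ (F : Finset (Fin k)) (i : Fin k), i ∉ F →
        KGraph.vertexSet (L.set F) =
          {v : Λ | G.sources v (Pi.single i 1) ⊆ KGraph.vertexSet (L.set F)} ∩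
            KGraph.vertexSet (L.set (insert i F))) ∧
      (∀ F : Finset (Fin k), KGraph.vertexSet (K.set F) ⊆ KGraph.vertexSet (L.set F)) := by
  -- That `L` consists of ideals is part of both sides, so the dictionary between ideals and vertex
  -- sets is available in either direction.
  constructor
  · rintro ⟨⟨hL, hT⟩, hle⟩
    exact ⟨hL, fun F i hi => (KGraph.eq_inv_inter_iff (hL F) (hL _) _).1 (hT F i hi),
      fun F => (KGraph.subset_iff_vertexSet_subset (hK F) (hL F)).1 (hle F)⟩
  · rintro ⟨hL, hT, hle⟩
    exact ⟨⟨hL, fun F i hi => (KGraph.eq_inv_inter_iff (hL F) (hL _) _).2 (hT F i hi)⟩,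
      fun F => (KGraph.subset_iff_vertexSet_subset (hK F) (hL F)).2 (hle F)⟩
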